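/- Let $n\ge 2$. Let $\mathbf B=\{1,\dots,n\}$ be the crystal of the vector representation of $U_q(\mathfrak q(n))$: the letter $x$ has weight $\varepsilon_x\in\bigoplus_{k=1}^n\mathbb Z\varepsilon_k$; for $1\le i\le n-1$, $\tilde f_i$ sends $i$ to $i+1$ and every other letter to $0$; $\tilde f_{\bar 1}$ sends $1$ to $2$ and every other letter to $0$; $\tilde e_i,\tilde e_{\bar 1}$ are the reversed partial maps; $\varepsilon_i(b)=\max\{k:\tilde e_i^kb\ne0\}$, $\varphi_i(b)=\max\{k:\tilde f_i^kb\neq 0\}$. For $N\ge0$, let $\mathbf B^{\otimes N}$ be the set of words $x_1\otimes\cdots\otimes x_N$ ($\mathbf B^{\otimes 0}$ being the one-element crystal of weight $0$, on which all operators are $0$), with $\mathrm{wt}$ additive and with the operators determined by the tensor product rule $$\tilde e_i(b_1\otimes b_2)=\begin{cases}\tilde e_ib_1\otimes b_2&\varphi_i(b_1)\ge\varepsilon_i(b_2)\\ b_1\otimes\tilde e_ib_2&\varphi_i(b_1)<\varepsilon_i(b_2)\end{cases}\qquad \tilde f_i(b_1\otimes b_2)=\begin{cases}\tilde f_ib_1\otimes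 b_2&\varphi_i(b_1)>\varepsilon_i(b_2)\\ b_1\otimes\tilde f_ib_2&\varphi_i(b_1)\le\varepsilon_i(b_2)\end{cases}$$ and $\tilde e_{\bar 1}(b_1\otimes b_2)=\tilde e_{\bar 1}b_1\otimes b_2$ if the coefficients of $\varepsilon_1$ and $\varepsilon_2$ in $\mathrm{wt}(b_2)$ both vanish, $\tilde e_{\bar 1}(b_1\otimes b_2)=b_1\otimes\tilde e_{\bar 1}b_2$ otherwise. For $1\le i\le n-1$ let $d_i(b)$ be the coefficient of $\varepsilon_i$ minus the coefficient of $\varepsilon_{i+1}$ in $\mathrm{wt}(b)$, and put $S_ib=\tilde f_i^{d_i(b)}b$ if $d_i(b)\ge0$, $S_ib=\tilde e_i^{-d_i(b)}b$ if $d_i(b)\le0$. Put $S_{w_i}=S_2\cdots S_i\,S_1\cdots S_{i-1}$ and $S_{w_i^{-1}}=S_{i-1}\cdots S_1\,S_i\cdots S_2$ (both are the identity for $i=1$), and $\tilde e_{\bar i}=S_{w_i^{-1}}\,\tilde e_{\bar 1}\,S_{w_i}$. An element $b$ is a $\mathfrak{gl}(n)$-highest weight vector if $\tilde e_ib=0$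 for all $1\le i\le n-1$, and a $\mathfrak q(n)$-highest weight vector if $\tilde e_ib=\tilde e_{\bar i}b=0$ for all $1\le i\le n-1$. A weight $\sum_k\lambda_k\varepsilon_k$ is a strict partition if all $\lambda_k\ge0$ and, for $1\le i\le n-1$, $\lambda_i\ge\lambda_{i+1}$ with equality only if $\lambda_i=\lambda_{i+1}=0$. **Theorem.** Let $N\ge1$ and $1\le j\le n$. Let $b\in\mathbf B^{\otimes(N-1)}$ be a $\mathfrak{gl}(n)$-highest weight vector, and assume that $b_0=1\otimes\tilde f_1\tilde f_2\cdots\tilde f_{j-1}b$ is (a nonzero element of $\mathbf B^{\otimes N}$ and) a $\mathfrak{gl}(n)$-highest weight vector in $\mathbf B^{\otimes N}$. Then $\mathrm{wt}(b_0)=\mathrm{wt}(b)+\varepsilon_j$, and $b_0$ is a $\mathfrak q(n)$-highest weight vector if and only if $b$ is a $\mathfrak q(n)$-highest weight vector and $\mathrm{wt}(b)+\varepsilon_j$ is a strict partition. -/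

import Mathlib

namespace QueerCrystal

/-! Elements `x₁ ⊗ x₂ ⊗ ⋯ ⊗ x_N` of `𝐁^{⊗N}` are written as lists `[x₁, x₂, …, x_N]` of letters
in `{1, …, n}`; thus `x :: w` is `x ⊗ w`.  The element `0` outside the crystal is `none`.
Indices are `1`-based: the even operators are `ẽ_i, f̃_i` for `1 ≤ i ≤ n - 1`. -/

/-- The underlying set of `𝐁^{⊗N}`, where `𝐁 = {1, …, n}` is the crystal of the vector
representation (and `𝐁^{⊗0}` is the trivial crystal with one element of weight `0`). -/
def tensorPow (n N : ℕ) : Set (List ℕ) :=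
  {b | b.length = N ∧ ∀ x ∈ b, 1 ≤ x ∧ x ≤ n}

/-- The weight: `wt b k = ⟨k_k, wt b⟩` is the number of letters `k` in `b`, that is,
`wt b = ∑ₖ (wt b k) ε_k`. -/
def wt (b : List ℕ) : ℕ → ℤ := fun k => (b.count k : ℤ)

/-- `ẽ_i` on `𝐁`: the arrow `i → i + 1` traversed backwards. -/
def letterE (i x : ℕ) : Option ℕ := if x = i + 1 then some i else none

/-- `f̃_i` on `𝐁`: the arrow `i → i + 1`. -/
def letterF (i x : ℕ) : Option ℕ := if x = i then some (i + 1) else none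

/-- `ε_i` on `𝐁`. -/
def letterEps (i x : ℕ) : ℕ := if x = i + 1 then 1 else 0

/-- `φ_i` on `𝐁`. -/
def letterPhi (i x : ℕ) : ℕ := if x = i then 1 else 0

/-- `ε_i` on tensor powers, by `ε_i(b₁ ⊗ b₂) = ε_i(b₁) + max(ε_i(b₂) - φ_i(b₁), 0)` (the
subtraction of natural numbers is truncated).  It is the maximal `k` with `ẽ_i^k b ≠ 0`, see
`iterOp_opE_ne_none_iff`. -/
def eps (i : ℕ) : List ℕ → ℕ
  | [] => 0
  | x :: w => letterEps i x + (eps i w - letterPhi i x)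

/-- `φ_i` on tensor powers, by `φ_i(b₁ ⊗ b₂) = φ_i(b₂) + max(φ_i(b₁) - ε_i(b₂), 0)` (the
subtraction of natural numbers is truncated).  It is the maximal `k` with `f̃_i^k b ≠ 0`, see
`iterOp_opF_ne_none_iff`. -/
def phi (i : ℕ) : List ℕ → ℕ
  | [] => 0
  | x :: w => phi i w + (letterPhi i x - eps i w)

/-- The even Kashiwara operator `ẽ_i` on tensor powers, by the tensor product rule:
`ẽ_i(b₁ ⊗ b₂)` is `ẽ_i b₁ ⊗ b₂` if `φ_i(b₁) ≥ ε_i(b₂)` and `b₁ ⊗ ẽ_i b₂` otherwise. -/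
def opE (i : ℕ) : List ℕ → Option (List ℕ)
  | [] => none
  | x :: w =>
    if eps i w ≤ letterPhi i x then (letterE i x).map (fun y => y :: w)
    else (opE i w).map (fun v => x :: v)

/-- The even Kashiwara operator `f̃_i` on tensor powers, by the tensor product rule:
`f̃_i(b₁ ⊗ b₂)` is `f̃_i b₁ ⊗ b₂` if `φ_i(b₁) > ε_i(b₂)` and `b₁ ⊗ f̃_i b₂` otherwise. -/
def opF (i : ℕ) : List ℕ → Option (List ℕ)
  | [] => none
  | x :: w =>
    if eps i w < letterPhi i x then (letterF i x).map (fun y => y :: w)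
    else (opF i w).map (fun v => x :: v)

/-- The odd Kashiwara operator `ẽ_{1̄}` on tensor powers.  On `𝐁` it is the arrow `1 → 2` traversed
backwards, and `ẽ_{1̄}(b₁ ⊗ b₂)` is `ẽ_{1̄} b₁ ⊗ b₂` if `⟨k₁, wt b₂⟩ = ⟨k₂, wt b₂⟩ = 0` and
`b₁ ⊗ ẽ_{1̄} b₂` otherwise. -/
def opOddE1 : List ℕ → Option (List ℕ)
  | [] => none
  | x :: w =>
    if wt w 1 = 0 ∧ wt w 2 = 0 then (letterE 1 x).map (fun y => y :: w)
    else (opOddE1 w).map (fun v => x :: v)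

/-- The `k`-th iterate of a partially defined operator. -/
def iterOp (g : List ℕ → Option (List ℕ)) : ℕ → List ℕ → Option (List ℕ)
  | 0, b => some b
  | k + 1, b => (g b).bind (iterOp g k)

/-- The composite `f̃_1 f̃_2 ⋯ f̃_m` (the identity for `m = 0`). -/
def opFChain : ℕ → List ℕ → Option (List ℕ)
  | 0, b => some b
  | m + 1, b => (opF (m + 1) b).bind (opFChain m)

/-- `S_i b` is `f̃_i^{⟨h_i, wt b⟩} b` if `⟨h_i, wt b⟩ ≥ 0` and `ẽ_i^{-⟨h_i, wt b⟩} b` otherwise,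
where `⟨h_i, wt b⟩ = wt b i - wt b (i + 1)`.  The iterate is never `0`, see `iterOp_eq_refl`, so the
default value in `getD` is never used. -/
def refl (i : ℕ) (b : List ℕ) : List ℕ :=
  if 0 ≤ wt b i - wt b (i + 1) then
    (iterOp (opF i) (wt b i - wt b (i + 1)).toNat b).getD b
  else
    (iterOp (opE i) (-(wt b i - wt b (i + 1))).toNat b).getD b

/-- `S_w = S_{i₁} S_{i₂} ⋯ S_{i_r}` for `w = s_{i₁} s_{i₂} ⋯ s_{i_r}`. -/
def weylS (l : List ℕ) (b : List ℕ) : List ℕ := l.foldr refl b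

/-- The expression `w_i = s_2 ⋯ s_i s_1 ⋯ s_{i-1}` (empty for `i = 1`). -/
def wExpr (i : ℕ) : List ℕ := List.range' 2 (i - 1) ++ List.range' 1 (i - 1)

/-- The odd Kashiwara operator `ẽ_{ī} = S_{w_i⁻¹} ẽ_{1̄} S_{w_i}` for `i ≥ 1`. -/
def opOddE (i : ℕ) (b : List ℕ) : Option (List ℕ) :=
  (opOddE1 (weylS (wExpr i) b)).map (weylS (wExpr i).reverse)

/-- `b` is a `𝔤𝔩(n)`-highest weight vector: `ẽ_i b = 0` for `1 ≤ i < n`. -/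
def IsGLHighestWeight (n : ℕ) (b : List ℕ) : Prop :=
  ∀ i, 1 ≤ i → i < n → opE i b = none

/-- `b` is a `𝔮(n)`-highest weight vector: `ẽ_i b = ẽ_{ī} b = 0` for `1 ≤ i < n`. -/
def IsQHighestWeight (n : ℕ) (b : List ℕ) : Prop :=
  ∀ i, 1 ≤ i → i < n → opE i b = none ∧ opOddE i b = none

/-- `(lam 1, …, lam n)` is a strict partition: nonnegative entries, weakly decreasing, and
`lam i = lam (i + 1)` only if both are `0`. -/
def IsStrictPartition (n : ℕ) (lam : ℕ → ℤ) : Prop :=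
  (∀ i, 1 ≤ i → i ≤ n → 0 ≤ lam i) ∧
  ∀ i, 1 ≤ i → i < n →
    lam (i + 1) ≤ lam i ∧ (lam i = lam (i + 1) → lam i = 0 ∧ lam (i + 1) = 0)

/-! ### The definitions behave as they should -/

theorem phi_sub_eps (i : ℕ) (b : List ℕ) :
    (phi i b : ℤ) - eps i b = wt b i - wt b (i + 1) := by
  induction b with
  | nil => simp [phi, eps, wt]
  | cons x w ih =>
    simp only [phi, eps, wt, letterEps, letterPhi, List.count_cons, beq_iff_eq] at *
    split_ifs <;> push_cast <;> omega

theorem opE_some {i : ℕ} {b c : List ℕ} (h : opE i b = some c) :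
    eps i b = eps i c + 1 ∧ phi i c = phi i b + 1 := by
  induction b generalizing c with
  | nil => simp [opE] at h
  | cons x w ih =>
    rw [opE] at h
    split_ifs at h with h1
    · simp only [letterE] at h
      split_ifs at h with h2 <;> simp at h
      subst h h2
      simp [eps, phi, letterEps, letterPhi] at *
      omega
    · obtain ⟨v, hv, rfl⟩ := Option.map_eq_some_iff.1 h
      have := ih hv
      simp only [eps, phi]
      omega

theorem opF_some {i : ℕ} {b c : List ℕ} (h : opF i b = some c) :
    eps i c = eps i b + 1 ∧ phi i b = phi i c + 1 := by
  induction b generalizing c with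
  | nil => simp [opF] at h
  | cons x w ih =>
    rw [opF] at h
    split_ifs at h with h1
    · simp only [letterF] at h
      split_ifs at h with h2 <;> simp at h
      subst h h2
      simp [eps, phi, letterEps, letterPhi] at *
      omega
    · obtain ⟨v, hv, rfl⟩ := Option.map_eq_some_iff.1 h
      have := ih hv
      simp only [eps, phi]
      omega

theorem opE_eq_none_iff (i : ℕ) (b : List ℕ) : opE i b = none ↔ eps i b = 0 := by
  induction b with
  | nil => simp [opE, eps]
  | cons x w ih =>
    by_cases h : eps i w ≤ letterPhi i x
    · simp only [opE, h, if_true, Option.map_eq_none_iff, eps, letterE, letterEps]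
      split_ifs <;> simp; omega
    · simp only [opE, h, if_false, Option.map_eq_none_iff, eps, ih]
      omega

theorem opF_eq_none_iff (i : ℕ) (b : List ℕ) : opF i b = none ↔ phi i b = 0 := by
  induction b with
  | nil => simp [opF, phi]
  | cons x w ih =>
    by_cases h : eps i w < letterPhi i x
    · simp only [opF, if_pos h, Option.map_eq_none_iff, phi, letterF]
      have h2 : x = i := by
        by_contra hne
        simp [letterPhi, hne] at h
      simp [h2] at h ⊢
      omega
    · simp only [opF, h, if_false, Option.map_eq_none_iff, phi, ih]
      omega

theorem iterOp_opE_ne_none_iff (i k : ℕ) (b : List ℕ) :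
    iterOp (opE i) k b ≠ none ↔ k ≤ eps i b := by
  induction k generalizing b with
  | zero => simp [iterOp]
  | succ k ih =>
    rcases h : opE i b with _ | c
    · simp [iterOp, h, (opE_eq_none_iff i b).1 h]
    · have h1 := opE_some h
      have h2 := ih c
      simp only [iterOp, h, Option.bind_some, h2]
      omega

theorem iterOp_opF_ne_none_iff (i k : ℕ) (b : List ℕ) :
    iterOp (opF i) k b ≠ none ↔ k ≤ phi i b := by
  induction k generalizing b with
  | zero => simp [iterOp]
  | succ k ih =>
    rcases h : opF i b with _ | c
    · simp [iterOp, h, (opF_eq_none_iff i b).1 h]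
    · have h1 := opF_some h
      have h2 := ih c
      simp only [iterOp, h, Option.bind_some, h2]
      omega

theorem iterOp_eq_refl (i : ℕ) (b : List ℕ) :
    (0 ≤ wt b i - wt b (i + 1) →
      iterOp (opF i) (wt b i - wt b (i + 1)).toNat b = some (refl i b)) ∧
    (wt b i - wt b (i + 1) < 0 →
      iterOp (opE i) (-(wt b i - wt b (i + 1))).toNat b = some (refl i b)) := by
  have h := phi_sub_eps i b
  constructor
  · intro h0
    have h1 := (iterOp_opF_ne_none_iff i (wt b i - wt b (i + 1)).toNat b).2 (by omega)
    obtain ⟨c, hc⟩ := Option.ne_none_iff_exists'.1 h1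
    simp only [refl, if_pos h0, hc, Option.getD_some]
  · intro h0
    have h1 := (iterOp_opE_ne_none_iff i (-(wt b i - wt b (i + 1))).toNat b).2 (by omega)
    obtain ⟨c, hc⟩ := Option.ne_none_iff_exists'.1 h1
    simp only [refl, if_neg (not_le.2 h0), hc, Option.getD_some]

/-- The tensor product rule for arbitrary factors: concatenation is the tensor product
`𝐁^{⊗M} ⊗ 𝐁^{⊗N} = 𝐁^{⊗(M+N)}`. -/
theorem eps_append (i : ℕ) (u v : List ℕ) :
    eps i (u ++ v) = eps i u + (eps i v - phi i u) ∧
    phi i (u ++ v) = phi i v + (phi i u - eps i v) := by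
  induction u with
  | nil => simp [eps, phi]
  | cons x w ih =>
    simp only [List.cons_append, eps, phi, ih]
    have : letterEps i x = 0 ∨ letterPhi i x = 0 := by
      simp only [letterEps, letterPhi]
      split_ifs <;> simp; omega
    constructor <;> omega

theorem opE_append (i : ℕ) (u v : List ℕ) (hu : u ≠ []) :
    opE i (u ++ v) = if eps i v ≤ phi i u then (opE i u).map (fun w => w ++ v)
      else (opE i v).map (fun w => u ++ w) := by
  induction u with
  | nil => exact absurd rfl hu
  | cons x w ih =>
    have h := (eps_append i w v).1
    have e1 : opE i (x :: w) = if eps i w ≤ letterPhi i x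
      then (letterE i x).map (fun y => y :: w) else (opE i w).map (fun v => x :: v) := rfl
    have e2 : opE i (x :: (w ++ v)) = if eps i (w ++ v) ≤ letterPhi i x
      then (letterE i x).map (fun y => y :: (w ++ v))
      else (opE i (w ++ v)).map (fun v => x :: v) := rfl
    have e3 : phi i (x :: w) = phi i w + (letterPhi i x - eps i w) := rfl
    rw [List.cons_append, e2, e1, e3, h]
    by_cases hw : w = []
    · subst hw
      simp [eps, phi, Function.comp_def]
    · rw [ih hw]
      split_ifs <;> first | omega | (simp [Function.comp_def])

theorem opF_append (i : ℕ) (u v : List ℕ) :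
    opF i (u ++ v) = if eps i v < phi i u then (opF i u).map (fun w => w ++ v)
      else (opF i v).map (fun w => u ++ w) := by
  induction u with
  | nil => simp [phi]
  | cons x w ih =>
    have h := (eps_append i w v).1
    have e1 : opF i (x :: w) = if eps i w < letterPhi i x
      then (letterF i x).map (fun y => y :: w) else (opF i w).map (fun v => x :: v) := rfl
    have e2 : opF i (x :: (w ++ v)) = if eps i (w ++ v) < letterPhi i x
      then (letterF i x).map (fun y => y :: (w ++ v))
      else (opF i (w ++ v)).map (fun v => x :: v) := rfl
    have e3 : phi i (x :: w) = phi i w + (letterPhi i x - eps i w) := rfl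
    rw [List.cons_append, e2, e1, e3, h, ih]
    split_ifs <;> first | omega | (simp [Function.comp_def])

theorem opOddE1_append (u v : List ℕ) :
    opOddE1 (u ++ v) = if wt v 1 = 0 ∧ wt v 2 = 0 then (opOddE1 u).map (fun w => w ++ v)
      else (opOddE1 v).map (fun w => u ++ w) := by
  induction u with
  | nil =>
    split_ifs with h
    · induction v with
      | nil => simp [opOddE1]
      | cons x w ih =>
        have h1 : x ≠ 1 ∧ x ≠ 2 ∧ (wt w 1 = 0 ∧ wt w 2 = 0) := by
          simp only [wt, List.count_cons, beq_iff_eq] at *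
          split_ifs at h <;> push_cast at h <;> omega
        simp [opOddE1, h1, letterE]
    · simp
  | cons x w ih =>
    simp only [List.cons_append, opOddE1, ih]
    have h1 : (wt (w ++ v) 1 = 0 ∧ wt (w ++ v) 2 = 0) ↔
        ((wt w 1 = 0 ∧ wt w 2 = 0) ∧ (wt v 1 = 0 ∧ wt v 2 = 0)) := by
      simp only [wt, List.count_append]
      push_cast
      omega
    simp only [h1]
    split_ifs <;> first | tauto | (simp [Function.comp_def])

/-- `ẽ_i` maps `𝐁^{⊗N}` to `𝐁^{⊗N} ⊔ {0}`. -/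
theorem opE_mem {n N i : ℕ} (hi : 1 ≤ i) {b c : List ℕ} (hb : b ∈ tensorPow n N)
    (h : opE i b = some c) : c ∈ tensorPow n N := by
  induction b generalizing c N with
  | nil => simp [opE] at h
  | cons x w ih =>
    obtain ⟨hl, hx⟩ := hb
    simp only [List.mem_cons, forall_eq_or_imp] at hx
    rw [opE] at h
    split_ifs at h with h1
    · simp only [letterE] at h
      split_ifs at h with h2 <;> simp at h
      subst h
      refine ⟨by simpa using hl, ?_⟩
      simp only [List.mem_cons, forall_eq_or_imp]
      exact ⟨by omega, hx.2⟩
    · obtain ⟨v, hv, rfl⟩ := Option.map_eq_some_iff.1 h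
      have h3 := ih (N := w.length) ⟨rfl, hx.2⟩ hv
      refine ⟨by simpa [h3.1] using hl, ?_⟩
      simp only [List.mem_cons, forall_eq_or_imp]
      exact ⟨hx.1, h3.2⟩

/-- `f̃_i` maps `𝐁^{⊗N}` to `𝐁^{⊗N} ⊔ {0}`. -/
theorem opF_mem {n N i : ℕ} (hi : i < n) {b c : List ℕ} (hb : b ∈ tensorPow n N)
    (h : opF i b = some c) : c ∈ tensorPow n N := by
  induction b generalizing c N with
  | nil => simp [opF] at h
  | cons x w ih =>
    obtain ⟨hl, hx⟩ := hb
    simp only [List.mem_cons, forall_eq_or_imp] at hx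
    rw [opF] at h
    split_ifs at h with h1
    · simp only [letterF] at h
      split_ifs at h with h2 <;> simp at h
      subst h
      refine ⟨by simpa using hl, ?_⟩
      simp only [List.mem_cons, forall_eq_or_imp]
      exact ⟨by omega, hx.2⟩
    · obtain ⟨v, hv, rfl⟩ := Option.map_eq_some_iff.1 h
      have h3 := ih (N := w.length) ⟨rfl, hx.2⟩ hv
      refine ⟨by simpa [h3.1] using hl, ?_⟩
      simp only [List.mem_cons, forall_eq_or_imp]
      exact ⟨hx.1, h3.2⟩

end QueerCrystal

namespace QueerCrystal

open scoped List

/-! Call a subword a, a+1, …, a+m−1 a chain. For a `𝔤𝔩(n)`-highest weight word, `ẽ_{ī} b = 0` means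
that every suffix containing the chain 2, …, i+1 also contains 1, …, i (`SuffixChains`,
`opOddE_eq_none_iff`). Indeed `S_{w_i}` acts as a succession of descents to the ends of strings, a
descent along a k-string preserves, in every suffix, each chain containing both k and k+1, and
`ẽ_{1̄}` only asks whether the last letter among 1, 2 is a 2.

The criterion forces strict weights: if `φ_i` vanished on a word containing 1, …, i, the chain could
be pushed to the right forever (`not_suffixChains`). So strictness of the weight of `b₀` is
available in both directions, and only the criteria for `b₀` and `b` remain to be compared.
Strictness gives `φ_k ≥ 2` each time `f̃_k` is applied, and then only chains starting with k+1 can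
appear in or vanish from a suffix (`range'_sublist_drop_opF_iff`). The criterion involves chains
starting with 1 or 2, so only `f̃_1` needs a separate argument (`suffixChains_opF_one_iff`). -/

/-! ### Chains in words and the vanishing of `ε_k` and `φ_k` -/

theorem range'_sublist_cons {a m x : ℕ} {w : List ℕ} :
    List.range' a (m + 1) <+ x :: w ↔
      List.range' a (m + 1) <+ w ∨ (x = a ∧ List.range' (a + 1) m <+ w) := by
  rw [List.sublist_cons_iff, List.range'_succ]
  simp only [List.cons.injEq]
  constructor
  · rintro (h | ⟨r, ⟨rfl, rfl⟩, h⟩)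
    · exact Or.inl h
    · exact Or.inr ⟨rfl, h⟩
  · rintro (h | ⟨rfl, h⟩)
    · exact Or.inl h
    · exact Or.inr ⟨_, ⟨rfl, rfl⟩, h⟩

theorem range'_tail_sublist {a m : ℕ} {w : List ℕ} (h : List.range' a (m + 1) <+ w) :
    List.range' (a + 1) m <+ w := by
  rw [List.range'_succ] at h
  exact (List.sublist_cons_self _ _).trans h

theorem eps_cons (k x : ℕ) (w : List ℕ) :
    eps k (x :: w) = (if x = k + 1 then 1 else 0) + (eps k w - if x = k then 1 else 0) := rfl

theorem phi_cons (k x : ℕ) (w : List ℕ) :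
    phi k (x :: w) = phi k w + ((if x = k then 1 else 0) - eps k w) := rfl

theorem mem_of_eps_pos {k : ℕ} {w : List ℕ} (h : 0 < eps k w) : k + 1 ∈ w := by
  induction w with
  | nil => simp [eps] at h
  | cons x w ih =>
    by_cases hx : x = k + 1
    · simp [hx]
    · rw [eps_cons, if_neg hx] at h
      exact List.mem_cons_of_mem _ (ih (by omega))

theorem mem_of_phi_pos {k : ℕ} {w : List ℕ} (h : 0 < phi k w) : k ∈ w := by
  induction w with
  | nil => simp [phi] at h
  | cons x w ih =>
    by_cases hx : x = k
    · simp [hx]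
    · rw [phi_cons, if_neg hx] at h
      exact List.mem_cons_of_mem _ (ih (by omega))

/-- If `ε_k` vanishes, an increasing chain starting with `k + 1` extends to one starting with
`k`. -/
theorem range'_sublist_of_eps_eq_zero {k m : ℕ} {w : List ℕ} (h : eps k w = 0)
    (hw : List.range' (k + 1) (m + 1) <+ w) : List.range' k (m + 2) <+ w := by
  induction w with
  | nil => simp at hw
  | cons x w ih =>
    rw [range'_sublist_cons] at hw ⊢
    rw [eps_cons] at h
    by_cases hx : x = k
    · rcases hw with hw | ⟨h1, -⟩
      · exact Or.inr ⟨hx, hw⟩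
      · omega
    · rcases hw with hw | ⟨h1, -⟩
      · exact Or.inl (ih (by simp [hx] at h; exact h.2) hw)
      · simp [h1] at h

/-- If `φ_k` vanishes, an increasing chain ending with `k` extends to one ending with `k + 1`. -/
theorem range'_sublist_of_phi_eq_zero {a m k : ℕ} {w : List ℕ} (hk : a + m = k) (h : phi k w = 0)
    (hw : List.range' a (m + 1) <+ w) : List.range' a (m + 2) <+ w := by
  induction w generalizing a m with
  | nil => simp at hw
  | cons x w ih =>
    rw [range'_sublist_cons] at hw ⊢
    rw [phi_cons] at h
    rcases hw with hw | ⟨rfl, hw⟩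
    · exact Or.inl (ih hk (by omega) hw)
    · refine Or.inr ⟨rfl, ?_⟩
      cases m with
      | zero =>
        have : 0 < eps k w := by
          rw [if_pos (by omega)] at h
          omega
        have := mem_of_eps_pos this
        simpa [show x = k by omega] using this
      | succ m => exact ih (by omega) (by omega) hw

/-- A word whose `ε_1, …, ε_m` vanish and which contains `m + 1` contains `1, …, m + 1` as a
subword. -/
theorem range'_sublist_of_mem {m : ℕ} {w : List ℕ} (h : ∀ k, 1 ≤ k → k < m + 1 → eps k w = 0)
    (hm : m + 1 ∈ w) : List.range' 1 (m + 1) <+ w := by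
  have key : ∀ d, d ≤ m → List.range' (m - d + 1) (d + 1) <+ w := by
    intro d
    induction d with
    | zero => simpa using hm
    | succ d ih =>
      intro hd
      have h1 := ih (by omega)
      rw [show m - d + 1 = (m - (d + 1) + 1) + 1 by omega] at h1
      exact range'_sublist_of_eps_eq_zero (h _ (by omega) (by omega)) h1
  simpa using key m le_rfl

/-! ### Chains under lowering along a k-string -/

/-- `Lower k w w'`: the word `w'` is obtained from `w` by applying powers of `f̃_k`
compatibly with the tensor product rule. -/
inductive Lower (k : ℕ) : List ℕ → List ℕ → Prop
  | rfl (w : List ℕ) : Lower k w w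
  | keep {x : ℕ} {w w' : List ℕ} : (x ≠ k ∨ 0 < eps k w) → Lower k w w' →
      Lower k (x :: w) (x :: w')
  | change {w w' : List ℕ} : eps k w = 0 → Lower k w w' → Lower k (k :: w) ((k + 1) :: w')

theorem Lower.drop {k : ℕ} {w w' : List ℕ} (h : Lower k w w') (l : ℕ) :
    Lower k (w.drop l) (w'.drop l) := by
  induction h generalizing l with
  | rfl w => exact .rfl _
  | keep h1 h2 ih =>
    cases l with
    | zero => exact .keep h1 h2
    | succ l => exact ih l
  | change h1 h2 ih =>
    cases l with
    | zero => exact .change h1 h2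
    | succ l => exact ih l

theorem Lower.eps_le {k i : ℕ} {w w' : List ℕ} (h : Lower k w w') (hi : i ≠ k) :
    eps i w' ≤ eps i w := by
  induction h with
  | rfl w => exact le_rfl
  | keep h1 h2 ih =>
    rw [eps_cons, eps_cons]
    omega
  | change h1 h2 ih =>
    rw [eps_cons, eps_cons, if_neg (show k + 1 ≠ i + 1 by omega), if_neg (Ne.symm hi)]
    omega

theorem Lower.mem_iff {k x : ℕ} {w w' : List ℕ} (h : Lower k w w') (h1 : x ≠ k)
    (h2 : x ≠ k + 1) : x ∈ w' ↔ x ∈ w := by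
  induction h with
  | rfl w => rfl
  | keep _ _ ih => simp [ih]
  | change _ _ ih => simp [ih, h1, h2]

/-- Chains of letters beyond `k` are kept by `f̃_k`. -/
theorem Lower.range'_mono {k a m : ℕ} {w w' : List ℕ} (h : Lower k w w') (ha : k < a)
    (hw : List.range' a m <+ w) : List.range' a m <+ w' := by
  induction h generalizing a m with
  | rfl w => exact hw
  | keep h1 h2 ih =>
    cases m with
    | zero => simp
    | succ m =>
      rw [range'_sublist_cons] at hw ⊢
      exact hw.imp (ih ha) (And.imp_right (ih (by omega)))
  | change h1 h2 ih =>
    cases m with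
    | zero => simp
    | succ m =>
      rw [range'_sublist_cons] at hw ⊢
      exact hw.imp (ih ha) (fun h => by omega)

/-- Chains of letters beyond `k + 1` are unaffected by `f̃_k`. -/
theorem Lower.range'_iff_of_lt {k a m : ℕ} {w w' : List ℕ} (h : Lower k w w') (ha : k + 1 < a) :
    List.range' a m <+ w' ↔ List.range' a m <+ w := by
  induction h generalizing a m with
  | rfl w => rfl
  | keep h1 h2 ih =>
    cases m with
    | zero => simp
    | succ m => rw [range'_sublist_cons, range'_sublist_cons, ih ha, ih (by omega)]
  | change h1 h2 ih =>
    cases m with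
    | zero => simp
    | succ m =>
      rw [range'_sublist_cons, range'_sublist_cons, ih ha]
      exact or_congr Iff.rfl (by constructor <;> intro h <;> omega)

/-- As `ε_k(w) > 0`, the first k+1 of `w` precedes every changed letter: the tail after a changed
letter has `ε_k = 0`. The chain can start at that k+1, its later letters being unaffected. -/
theorem Lower.range'_of_eps_pos {k m : ℕ} {w w' : List ℕ} (h : Lower k w w') (hk : 0 < eps k w)
    (hw : List.range' (k + 1) m <+ w') : List.range' (k + 1) m <+ w := by
  induction h generalizing m with
  | rfl w => exact hw
  | @keep x w w' h1 h2 ih =>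
    cases m with
    | zero => simp
    | succ m =>
      rw [range'_sublist_cons] at hw ⊢
      rw [eps_cons] at hk
      by_cases hx : x = k + 1
      · refine Or.inr ⟨hx, ?_⟩
        rw [← h2.range'_iff_of_lt (by omega)]
        rcases hw with hw | hw
        · exact range'_tail_sublist hw
        · exact hw.2
      · rw [if_neg hx] at hk
        exact Or.inl (ih (by omega) (hw.resolve_right (fun h => hx h.1)))
  | change h1 h2 ih =>
    rw [eps_cons] at hk
    simp [h1] at hk

/-- Chains containing both `k` and `k + 1` are preserved by the `k`-strings. -/
theorem Lower.range'_iff {k a m : ℕ} {w w' : List ℕ} (h : Lower k w w') (ha : a ≤ k)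
    (hm : k + 1 < a + m) : List.range' a m <+ w' ↔ List.range' a m <+ w := by
  induction h generalizing a m with
  | rfl w => rfl
  | @keep x w w' h1 h2 ih =>
    obtain ⟨m, rfl⟩ : ∃ p, m = p + 1 := ⟨m - 1, by omega⟩
    rw [range'_sublist_cons, range'_sublist_cons, ih ha hm]
    refine or_congr Iff.rfl (and_congr_right fun hx => ?_)
    rcases ha.lt_or_eq with ha | rfl
    · exact ih (by omega) (by omega)
    -- A kept k is matched by a later k+1, so `ε_k` of the tail is positive.
    · exact ⟨h2.range'_of_eps_pos (h1.resolve_left (by simp [hx])),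
        h2.range'_mono (by omega)⟩
  | @change w w' h1 h2 ih =>
    obtain ⟨m, rfl⟩ : ∃ p, m = p + 1 := ⟨m - 1, by omega⟩
    rw [range'_sublist_cons, range'_sublist_cons, ih ha hm]
    constructor
    · exact Or.imp id (fun h => by omega)
    · rintro (h | ⟨rfl, h⟩)
      · exact Or.inl h
      · obtain ⟨m, rfl⟩ : ∃ p, m = p + 1 := ⟨m - 1, by omega⟩
        -- The changed k is dispensable: `ε_k` of the tail vanishes, so the rest of the chain
        -- extends to one from k inside the tail.
        exact Or.inl (range'_sublist_of_eps_eq_zero h1 h)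

/-- Chains of letters below `k` are unaffected by `f̃_k`. -/
theorem Lower.range'_iff_of_le {k a m : ℕ} {w w' : List ℕ} (h : Lower k w w') (ha : a + m ≤ k) :
    List.range' a m <+ w' ↔ List.range' a m <+ w := by
  induction h generalizing a m with
  | rfl w => rfl
  | keep h1 h2 ih =>
    cases m with
    | zero => simp
    | succ m => rw [range'_sublist_cons, range'_sublist_cons, ih ha, ih (by omega)]
  | change h1 h2 ih =>
    cases m with
    | zero => simp
    | succ m =>
      rw [range'_sublist_cons, range'_sublist_cons, ih ha]
      exact or_congr Iff.rfl (by constructor <;> intro h <;> omega)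

/-! ### A single application of `f̃_k` -/

theorem opF_cons_eq_some {k x : ℕ} {w c : List ℕ} :
    opF k (x :: w) = some c ↔ (x = k ∧ eps k w = 0 ∧ c = (k + 1) :: w) ∨
      ((x ≠ k ∨ 0 < eps k w) ∧ ∃ w', opF k w = some w' ∧ c = x :: w') := by
  by_cases hx : x = k <;> by_cases hw : eps k w = 0 <;>
    simp [opF, letterPhi, letterF, hx, hw, eq_comm, Nat.pos_iff_ne_zero]

theorem lower_of_opF {k : ℕ} {w w' : List ℕ} (h : opF k w = some w') : Lower k w w' := by
  induction w generalizing w' with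
  | nil => simp [opF] at h
  | cons x w ih =>
    rcases opF_cons_eq_some.1 h with ⟨rfl, h1, rfl⟩ | ⟨h1, v, hv, rfl⟩
    · exact .change h1 (.rfl _)
    · exact .keep h1 (ih hv)

/-- `f̃_k` changes the leftmost unmatched k. If this letter lies in the suffix, so do all unmatched
k, whence the equality of `φ_k`. -/
theorem opF_drop {k : ℕ} {w w' : List ℕ} (h : opF k w = some w') (l : ℕ) :
    w'.drop l = w.drop l ∨
      (opF k (w.drop l) = some (w'.drop l) ∧ phi k (w.drop l) = phi k w) := by
  induction w generalizing w' l with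
  | nil => simp [opF] at h
  | cons x w ih =>
    cases l with
    | zero => exact Or.inr ⟨h, rfl⟩
    | succ l =>
      rcases opF_cons_eq_some.1 h with ⟨rfl, h1, rfl⟩ | ⟨h1, v, hv, rfl⟩
      · exact Or.inl rfl
      · refine (ih hv l).imp id (And.imp id fun h => ?_)
        rw [List.drop_succ_cons, h, phi_cons]
        split_ifs <;> omega

/-- Only the leftmost unmatched k is lost. As `φ_k ≥ 2`, another one stands further right and can
end the chain instead. -/
theorem range'_sublist_of_opF {k a m : ℕ} {w w' : List ℕ} (h : opF k w = some w')
    (hk : 2 ≤ phi k w) (ha : a + m = k) (hw : List.range' a (m + 1) <+ w) :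
    List.range' a (m + 1) <+ w' := by
  induction w generalizing a m w' with
  | nil => simp [opF] at h
  | cons x w ih =>
    rw [range'_sublist_cons] at hw
    rw [phi_cons] at hk
    rcases opF_cons_eq_some.1 h with ⟨rfl, h1, rfl⟩ | ⟨h1, v, hv, rfl⟩
    · rw [if_pos rfl] at hk
      rw [range'_sublist_cons]
      left
      rcases hw with hw | ⟨rfl, hw⟩
      · exact hw
      · obtain rfl : m = 0 := by omega
        simpa using mem_of_phi_pos (show 0 < phi x w by omega)
    · have hp : 2 ≤ phi k w := by split_ifs at hk <;> omega
      rw [range'_sublist_cons]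
      rcases hw with hw | ⟨rfl, hw⟩
      · exact Or.inl (ih hv hp ha hw)
      · refine Or.inr ⟨rfl, ?_⟩
        cases m with
        | zero => simp
        | succ m => exact ih hv hp (by omega) hw

theorem Lower.range'_anti {k a m : ℕ} {w w' : List ℕ} (h : Lower k w w') (ha : a + m = k)
    (hw : List.range' a (m + 1) <+ w') : List.range' a (m + 1) <+ w := by
  induction h generalizing a m with
  | rfl w => exact hw
  | keep h1 h2 ih =>
    rw [range'_sublist_cons] at hw ⊢
    refine hw.imp (ih ha) (And.imp_right fun hw => ?_)
    cases m with
    | zero => simp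
    | succ m => exact ih (by omega) hw
  | change h1 h2 ih =>
    rw [range'_sublist_cons] at hw ⊢
    exact hw.imp (ih ha) (fun h => by omega)

/-- If `φ_k(w) ≥ 2`, applying `f̃_k` neither creates nor destroys chains in suffixes of `w`, except
for chains starting with `k + 1`. -/
theorem range'_sublist_drop_opF_iff {k a m : ℕ} {w w' : List ℕ} (h : opF k w = some w')
    (hk : 2 ≤ phi k w) (ha : a ≠ k + 1) (l : ℕ) :
    List.range' a m <+ w'.drop l ↔ List.range' a m <+ w.drop l := by
  have hL := (lower_of_opF h).drop l
  rcases Nat.lt_or_ge (k + 1) a with h1 | h1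
  · exact hL.range'_iff_of_lt h1
  rcases Nat.lt_or_ge (k + 1) (a + m) with h2 | h2
  · exact hL.range'_iff (by omega) h2
  rcases Nat.lt_or_ge k (a + m) with h3 | h3
  · obtain ⟨m, rfl⟩ : ∃ p, m = p + 1 := ⟨m - 1, by omega⟩
    refine ⟨hL.range'_anti (by omega), fun hw => ?_⟩
    rcases opF_drop h l with h4 | ⟨h4, h5⟩
    · rwa [h4]
    · exact range'_sublist_of_opF h4 (by omega) (by omega) hw
  · exact hL.range'_iff_of_le h3

/-! ### Lowest elements of k-strings -/

/-- The lowest element `f̃_k^{φ_k(b)} b` of the `k`-string through `b`. -/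
def lowest (k : ℕ) : List ℕ → List ℕ
  | [] => []
  | x :: w => (if x = k ∧ eps k w = 0 then k + 1 else x) :: lowest k w

theorem lowest_lower (k : ℕ) (w : List ℕ) : Lower k w (lowest k w) := by
  induction w with
  | nil => exact .rfl _
  | cons x w ih =>
    rw [lowest]
    split_ifs with h
    · rw [h.1]
      exact .change h.2 ih
    · exact .keep (by omega) ih

theorem lowest_of_phi_eq_zero {k : ℕ} {w : List ℕ} (h : phi k w = 0) : lowest k w = w := by
  induction w with
  | nil => rfl
  | cons x w ih =>
    rw [phi_cons] at h
    rw [lowest, ih (by omega), if_neg]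
    rintro ⟨rfl, h1⟩
    simp [h1] at h

theorem lowest_of_opF {k : ℕ} {w w' : List ℕ} (h : opF k w = some w') :
    lowest k w' = lowest k w := by
  induction w generalizing w' with
  | nil => simp [opF] at h
  | cons x w ih =>
    rcases opF_cons_eq_some.1 h with ⟨rfl, h1, rfl⟩ | ⟨h1, v, hv, rfl⟩
    · simp [lowest, h1]
    · have h2 := (opF_some hv).1
      rw [lowest, lowest, ih hv, if_neg (by omega), if_neg (by omega)]

theorem iterOp_opF_phi (k : ℕ) (w : List ℕ) :
    iterOp (opF k) (phi k w) w = some (lowest k w) := by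
  generalize hp : phi k w = p
  induction p generalizing w with
  | zero => rw [iterOp, lowest_of_phi_eq_zero hp]
  | succ p ih =>
    rcases h : opF k w with _ | v
    · rw [opF_eq_none_iff] at h
      omega
    · rw [iterOp, h, Option.bind_some, ih v (by have := opF_some h; omega), lowest_of_opF h]

theorem refl_eq_lowest {k : ℕ} {b : List ℕ} (h : eps k b = 0) : refl k b = lowest k b := by
  have h1 := phi_sub_eps k b
  rw [refl, if_pos (by omega), show (wt b k - wt b (k + 1)).toNat = phi k b by omega,
    iterOp_opF_phi, Option.getD_some]

/-- Whether a letter changes depends only on the letters after it. This is what makes conditions on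
suffixes tractable. -/
theorem lowest_drop (k : ℕ) (w : List ℕ) (l : ℕ) :
    (lowest k w).drop l = lowest k (w.drop l) := by
  induction w generalizing l with
  | nil => simp [lowest]
  | cons x w ih =>
    cases l with
    | zero => rfl
    | succ l => exact ih l

/-- The letters changed inside `u` are its unmatched k that are not matched by a k+1 of `v`; their
number is the truncated difference. -/
theorem lowest_append (k : ℕ) (u v : List ℕ) : ∃ u', u'.length = u.length ∧
    lowest k (u ++ v) = u' ++ lowest k v ∧
    u'.count (k + 1) = u.count (k + 1) + (phi k u - eps k v) ∧
    u'.count k + (phi k u - eps k v) = u.count k ∧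
    ∀ i, i ≠ k → i ≠ k + 1 → u'.count i = u.count i := by
  induction u with
  | nil => exact ⟨[], by simp [phi]⟩
  | cons x u ih =>
    obtain ⟨u', h0, h1, h2, h3, h4⟩ := ih
    refine ⟨(if x = k ∧ eps k (u ++ v) = 0 then k + 1 else x) :: u', by simp [h0], ?_, ?_, ?_,
      fun i hi hi' => ?_⟩
    · rw [List.cons_append, lowest, h1, List.cons_append]
    · rw [(eps_append k u v).1, phi_cons]
      simp only [List.count_cons, beq_iff_eq, h2]
      split_ifs <;> omega
    · rw [(eps_append k u v).1, phi_cons, ← Nat.add_right_cancel_iff (n := 0)]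
      simp only [List.count_cons, beq_iff_eq]
      split_ifs <;> omega
    · simp only [List.count_cons, beq_iff_eq, h4 i hi hi']
      split_ifs <;> omega

/-- The leftmost unmatched k+1 would end a prefix with more k+1 than k. The criterion reduces `ε_k =
0` to counting letters. -/
theorem eps_eq_zero_of_take {k : ℕ} {w : List ℕ}
    (h : ∀ l, (w.take l).count (k + 1) ≤ (w.take l).count k) : eps k w = 0 := by
  induction w using List.reverseRecOn with
  | nil => rfl
  | append_singleton u a ih =>
    have hu : eps k u = 0 := by
      refine ih fun l => ?_
      have := h (min l u.length)
      rwa [List.take_append_of_le_length (by omega), ← List.take_take, List.take_length] at this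
    have h1 := h (u.length + 1)
    rw [List.take_of_length_le (by simp)] at h1
    have h2 := phi_sub_eps k (u ++ [a])
    have h3 := eps_append k u [a]
    have h4 := phi_sub_eps k u
    simp only [wt, List.count_append] at h1 h2 h4
    simp only [List.count_singleton, eps, phi, letterEps, letterPhi, beq_iff_eq] at *
    split_ifs at * <;> push_cast at * <;> omega

/-- If `b` is a highest weight vector for `ẽ_k` and `ẽ_{k+1}`, then `ẽ_{k+1} S_k S_{k+1} b = 0`. -/
theorem eps_lowest_lowest {k : ℕ} {b : List ℕ} (h1 : eps k b = 0) (h2 : eps (k + 1) b = 0) :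
    eps (k + 1) (lowest k (lowest (k + 1) b)) = 0 := by
  refine eps_eq_zero_of_take fun l => ?_
  obtain ⟨u1, l1, e1, a1, b1, c1⟩ := lowest_append (k + 1) (b.take l) (b.drop l)
  obtain ⟨u2, l2, e2, a2, b2, c2⟩ := lowest_append k u1 (lowest (k + 1) (b.drop l))
  rw [List.take_append_drop] at e1
  have e3 : (lowest k (lowest (k + 1) b)).take l = u2 := by
    rcases le_total l b.length with hl | hl
    · rw [e1, e2, List.take_left' (by simp [l2, l1, hl])]
    · rw [e1, e2, List.drop_of_length_le hl, lowest, lowest, List.append_nil,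
        List.take_of_length_le]
      simp [l2, l1]
  rw [e3]
  have f1 := (lowest_lower (k + 1) b).eps_le (show k ≠ k + 1 by omega)
  have f2 := (lowest_lower (k + 1) (b.drop l)).eps_le (show k ≠ k + 1 by omega)
  rw [e1, (eps_append _ _ _).1] at f1
  have g1 := (eps_append k (b.take l) (b.drop l)).1
  have g2 := (eps_append (k + 1) (b.take l) (b.drop l)).1
  rw [List.take_append_drop] at g1 g2
  have p1 := phi_sub_eps k u1
  have p2 := phi_sub_eps k (b.take l)
  have p3 := phi_sub_eps (k + 1) (b.take l)
  simp only [wt] at p1 p2 p3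
  have q1 := c1 k (by omega) (by omega)
  have q2 := c2 (k + 1 + 1) (by omega) (by omega)
  -- Let c_i count the letters i in the prefix of `b`. After both descents there are c_{k+1} −
  -- ε_{k+1}(suffix) letters k+2, and at least c_k − ε_k(suffix) ≥ c_{k+1} letters k+1.
  omega

/-! ### `S_{w_i}` on highest weight words -/

/-- The composite `f̃_{i₁}^{max} ⋯ f̃_{i_r}^{max}`. -/
def lowestFold (l : List ℕ) (b : List ℕ) : List ℕ := l.foldr lowest b

theorem lowestFold_drop (s : List ℕ) (w : List ℕ) (l : ℕ) :
    (lowestFold s w).drop l = lowestFold s (w.drop l) := by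
  induction s with
  | nil => rfl
  | cons k s ih => exact (lowest_drop _ _ _).trans (congrArg _ ih)

theorem eps_lowestFold_le {i : ℕ} {s : List ℕ} (hs : i ∉ s) (w : List ℕ) :
    eps i (lowestFold s w) ≤ eps i w := by
  induction s with
  | nil => exact le_rfl
  | cons k s ih =>
    rw [List.mem_cons, not_or] at hs
    exact ((lowest_lower _ _).eps_le hs.1).trans (ih hs.2)

/-- Larger indices act first and do not increase `ε_a`, so each reflection meets the top of its
string and descends to the bottom. -/
theorem weylS_range'_eq {a m : ℕ} {b : List ℕ} (h : ∀ k, a ≤ k → k < a + m → eps k b = 0) :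
    weylS (List.range' a m) b = lowestFold (List.range' a m) b := by
  induction m generalizing a with
  | zero => rfl
  | succ m ih =>
    have h1 := ih (a := a + 1) (fun k hk hk' => h k (by omega) (by omega))
    rw [List.range'_succ]
    change refl a (weylS _ b) = lowest a (lowestFold _ b)
    rw [h1, refl_eq_lowest]
    have := eps_lowestFold_le (i := a) (s := List.range' (a + 1) m) (by simp) b
    have := h a le_rfl (by omega)
    omega

theorem lowestFold_append (s t : List ℕ) (b : List ℕ) :
    lowestFold (s ++ t) b = lowestFold s (lowestFold t b) := List.foldr_append

theorem eps_lowestFold_range' {i k : ℕ} {b : List ℕ} (h : ∀ j, 1 ≤ j → j ≤ i → eps j b = 0)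
    (hk : 2 ≤ k) (hki : k ≤ i) : eps k (lowestFold (List.range' 1 (i - 1)) b) = 0 := by
  rcases hki.lt_or_eq with hki | rfl
  -- Indices above k keep `ε_{k-1}` and `ε_k` zero, the pair k−1, k is covered by
  -- `eps_lowest_lowest`, and indices below k−1 do not raise `ε_k`.
  · have e : List.range' 1 (i - 1) =
        List.range' 1 (k - 2) ++ (k - 1) :: k :: List.range' (k + 1) (i - 1 - k) := by
      conv_lhs => rw [show i - 1 = (k - 2) + (1 + (1 + (i - 1 - k))) by omega]
      rw [← List.range'_append_1, ← List.range'_append_1, ← List.range'_append_1]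
      simp [show 1 + (k - 2) = k - 1 by omega, show k - 1 + 1 = k by omega]
    rw [e, lowestFold_append]
    refine Nat.le_zero.1 ((eps_lowestFold_le ?_ _).trans ?_)
    · simp
      omega
    · obtain ⟨k, rfl⟩ : ∃ p, k = p + 1 := ⟨k - 1, by omega⟩
      refine (eps_lowest_lowest (k := k) ?_ ?_).le <;>
        refine Nat.le_zero.1 ((eps_lowestFold_le (by simp) _).trans (h _ ?_ ?_).le) <;> omega
  · exact Nat.le_zero.1 ((eps_lowestFold_le (by simp; omega) _).trans (h _ (by omega) le_rfl).le)

theorem weylS_wExpr_eq {i : ℕ} {b : List ℕ} (h : ∀ j, 1 ≤ j → j ≤ i → eps j b = 0) :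
    weylS (wExpr i) b = lowestFold (List.range' 2 (i - 1))
      (lowestFold (List.range' 1 (i - 1)) b) := by
  have h1 : weylS (wExpr i) b =
      weylS (List.range' 2 (i - 1)) (weylS (List.range' 1 (i - 1)) b) := List.foldr_append
  rw [h1, weylS_range'_eq (fun k hk hk' => h k hk (by omega)),
    weylS_range'_eq (fun k hk hk' => eps_lowestFold_range' h hk (by omega))]

/-! ### The odd operators in terms of chains -/

/-- `ẽ_{1̄}` acts on the last letter among 1 and 2, and gives 0 unless that letter is a 2. -/
theorem opOddE1_eq_none_iff (b : List ℕ) :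
    opOddE1 b = none ↔ ∀ l, 2 ∈ b.drop l → 1 ∈ b.drop l := by
  induction b with
  | nil => simp [opOddE1]
  | cons x w ih =>
    have key : (∀ l, 2 ∈ (x :: w).drop l → 1 ∈ (x :: w).drop l) ↔
        (2 ∈ x :: w → 1 ∈ x :: w) ∧ ∀ l, 2 ∈ w.drop l → 1 ∈ w.drop l :=
      ⟨fun h => ⟨h 0, fun l => h (l + 1)⟩, fun h l => by
        cases l with
        | zero => exact h.1
        | succ l => exact h.2 l⟩
    rw [key, opOddE1]
    split_ifs with h
    · simp only [wt, Nat.cast_eq_zero, List.count_eq_zero] at h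
      have h2 : ∀ l, 2 ∈ w.drop l → 1 ∈ w.drop l :=
        fun l hl => absurd (List.mem_of_mem_drop hl) h.2
      rw [and_iff_left h2]
      by_cases hx : x = 2 <;> simp [letterE, h, hx, eq_comm]
    · simp only [wt, Nat.cast_eq_zero, List.count_eq_zero] at h
      rw [Option.map_eq_none_iff, ih]
      refine ⟨fun h1 => ⟨fun _ => ?_, h1⟩, fun h1 => h1.2⟩
      have h0 := h1 0
      rw [List.drop_zero] at h0
      exact List.mem_cons_of_mem _ (by tauto)

theorem eps_pos_of_mem_lowest {k : ℕ} {w : List ℕ} (h : k ∈ lowest k w) :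
    ∃ l, 0 < eps k (w.drop (l + 1)) ∧ w.drop l = k :: w.drop (l + 1) := by
  induction w with
  | nil => simp [lowest] at h
  | cons x w ih =>
    rw [lowest, List.mem_cons] at h
    by_cases h1 : k ∈ lowest k w
    · obtain ⟨l, hl⟩ := ih h1
      exact ⟨l + 1, hl⟩
    · refine ⟨0, ?_⟩
      have h2 := h.resolve_right h1
      split_ifs at h2 with h3
      · omega
      · subst h2
        simpa [Nat.pos_iff_ne_zero] using h3

theorem range'_sublist_lowestFold_iff {a m c p : ℕ} (ha : c ≤ a) (hm : a + m < c + p)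
    (w : List ℕ) :
    List.range' c p <+ lowestFold (List.range' a m) w ↔ List.range' c p <+ w := by
  induction m generalizing a with
  | zero => rfl
  | succ m ih =>
    rw [List.range'_succ]
    exact ((lowest_lower a _).range'_iff ha (by omega)).trans (ih (by omega) (by omega))

/-- A letter a surviving the descent along its string is matched by a later a+1, which itself
survived the earlier descents; iterating produces the chain. Conversely, all these descents preserve
the chain. -/
theorem mem_lowestFold_iff (a m : ℕ) (w : List ℕ) :
    a ∈ lowestFold (List.range' a m) w ↔ List.range' a (m + 1) <+ w := by
  rw [← range'_sublist_lowestFold_iff (a := a) (m := m) le_rfl (by omega)]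
  refine ⟨fun h => ?_, fun h => h.subset (by simp)⟩
  suffices hs : List.range' a (m + 1) <+ w by
    rwa [range'_sublist_lowestFold_iff le_rfl (by omega)]
  induction m generalizing a w with
  | zero => simpa [lowestFold] using h
  | succ m ih =>
    rw [List.range'_succ] at h
    obtain ⟨l, h1, h2⟩ := eps_pos_of_mem_lowest h
    have h3 := mem_of_eps_pos h1
    change a + 1 ∈ (lowestFold (List.range' (a + 1) m) w).drop (l + 1) at h3
    rw [lowestFold_drop] at h3
    have h4 := (range'_sublist_lowestFold_iff (a := a + 1) (m := m) le_rfl (by omega) _).2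
      (ih _ _ h3)
    rw [← lowestFold_drop] at h4
    have h5 : List.range' a (m + 1 + 1) <+ (lowestFold (List.range' (a + 1) m) w).drop l := by
      change (lowestFold (List.range' (a + 1) m) w).drop l = _ at h2
      rw [h2, List.range'_succ]
      exact h4.cons_cons a
    rw [lowestFold_drop, range'_sublist_lowestFold_iff (by omega) (by omega)] at h5
    exact h5.trans (List.drop_sublist _ _)

theorem mem_lowestFold_iff_of_lt {a m x : ℕ} (hx : x < a) (w : List ℕ) :
    x ∈ lowestFold (List.range' a m) w ↔ x ∈ w := by
  induction m generalizing a with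
  | zero => rfl
  | succ m ih =>
    rw [List.range'_succ]
    exact ((lowest_lower a _).mem_iff (by omega) (by omega)).trans (ih (by omega))

/-- Every suffix of `b` containing the subword `2, …, i + 1` contains the subword `1, …, i`. -/
def SuffixChains (i : ℕ) (b : List ℕ) : Prop :=
  ∀ l, List.range' 2 i <+ b.drop l → List.range' 1 i <+ b.drop l

theorem range'_sublist_lowest_succ {k m : ℕ} {w : List ℕ}
    (h : List.range' (k + 1) (m + 1) <+ lowest k w) :
    List.range' (k + 1) (m + 1) <+ w ∨
      ∃ l, w.drop l = k :: w.drop (l + 1) ∧ List.range' (k + 2) m <+ w.drop (l + 1) := by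
  induction w with
  | nil => simp [lowest] at h
  | cons x w ih =>
    rw [lowest, range'_sublist_cons] at h
    rcases h with h | ⟨h1, h2⟩
    · rcases ih h with h | ⟨l, h⟩
      · exact Or.inl (h.trans (List.sublist_cons_self _ _))
      · exact Or.inr ⟨l + 1, h⟩
    · rw [(lowest_lower k w).range'_iff_of_lt (by omega)] at h2
      split_ifs at h1 with h3
      · exact Or.inr ⟨0, by simp [h3.1], h2⟩
      · exact Or.inl (range'_sublist_cons.2 (Or.inr ⟨h1, h2⟩))

theorem exists_drop_eq_of_mem {x : ℕ} {w : List ℕ} (h : x ∈ w) :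
    ∃ l, w.drop l = x :: w.drop (l + 1) ∧ x ∉ w.drop (l + 1) := by
  induction w with
  | nil => simp at h
  | cons y w ih =>
    by_cases h1 : x ∈ w
    · obtain ⟨l, hl⟩ := ih h1
      exact ⟨l + 1, hl⟩
    · obtain rfl : x = y := by simpa [h1] using h
      exact ⟨0, by simpa using h1⟩

theorem suffixChains_one_iff (b : List ℕ) :
    SuffixChains 1 b ↔ ∀ l, 2 ∈ b.drop l → 1 ∈ b.drop l := by
  simp [SuffixChains]

/-- For a highest weight vector `b`, the condition `ẽ_{ī} b = 0` in terms of subwords of the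
suffixes of `b`. -/
theorem opOddE_eq_none_iff {i : ℕ} {b : List ℕ} (hi : 1 ≤ i)
    (h : ∀ j, 1 ≤ j → j ≤ i → eps j b = 0) : opOddE i b = none ↔ SuffixChains i b := by
  rw [opOddE, Option.map_eq_none_iff, weylS_wExpr_eq h, opOddE1_eq_none_iff]
  obtain ⟨i, rfl⟩ : ∃ p, i = p + 1 := ⟨i - 1, by omega⟩
  rw [Nat.add_sub_cancel]
  cases i with
  | zero => exact (suffixChains_one_iff b).symm
  | succ i =>
    have h1 : ∀ l, 1 ∈ (lowestFold (List.range' 2 (i + 1))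
        (lowestFold (List.range' 1 (i + 1)) b)).drop l ↔
        List.range' 1 (i + 2) <+ b.drop l := fun l => by
      rw [lowestFold_drop, lowestFold_drop, mem_lowestFold_iff_of_lt (by omega),
        mem_lowestFold_iff]
    set z := lowestFold (List.range' 2 i) b with hz
    have h2 : ∀ l, 2 ∈ (lowestFold (List.range' 2 (i + 1))
        (lowestFold (List.range' 1 (i + 1)) b)).drop l ↔
        List.range' 2 (i + 2) <+ lowest 1 (z.drop l) := fun l => by
      rw [lowestFold_drop, mem_lowestFold_iff, ← lowest_drop]
      rfl
    have h3 : ∀ l, List.range' 2 (i + 2) <+ z.drop l ↔ List.range' 2 (i + 2) <+ b.drop l :=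
      fun l => by rw [hz, lowestFold_drop, range'_sublist_lowestFold_iff le_rfl (by omega)]
    have h4 : ∀ l, List.range' 1 (i + 2) <+ z.drop l ↔ List.range' 1 (i + 2) <+ b.drop l :=
      fun l => by rw [hz, lowestFold_drop, range'_sublist_lowestFold_iff (by omega) (by omega)]
    have h5 : ∀ l, 2 ∈ z.drop l ↔ List.range' 2 (i + 1) <+ z.drop l := fun l => by
      rw [hz, lowestFold_drop, mem_lowestFold_iff,
        range'_sublist_lowestFold_iff le_rfl (by omega)]
    simp only [h1, h2]
    constructor
    · intro hg l hl
      exact hg l ((lowest_lower 1 _).range'_mono (by omega) ((h3 l).2 hl))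
    · intro hg l hl
      rcases range'_sublist_lowest_succ hl with hl | ⟨p, hp, hc⟩
      · exact hg l ((h3 l).1 hl)
      simp only [List.drop_drop, ← add_assoc] at hp hc
      set t := l + p with ht
      -- Here the 2 starting the chain arose from a 1 at position `t`. The letter i+3 cannot be
      -- created by the descents defining `z`, so it is in `b`, which then contains 1, …, i+3.
      have hz2 : 2 ∈ z := by
        have hmem : i + 1 + 2 ∈ z := List.mem_of_mem_drop (i := t + 1) (hc.subset (by simp; omega))
        have hb : i + 2 + 1 ∈ b := by
          by_contra hcon
          have hno : ∀ s w, (i + 2 + 1 ∉ w) → (∀ k ∈ s, k + 1 < i + 2 + 1) →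
              i + 2 + 1 ∉ lowestFold s w := by
            intro s w hw hs
            induction s with
            | nil => exact hw
            | cons k s ih =>
              have hk := hs k (by simp)
              refine fun hcc => ih (fun k hk => hs k (by simp [hk])) ?_
              exact ((lowest_lower k _).mem_iff (by omega) (by omega)).1 hcc
          exact hno _ _ hcon (fun k hk => by simp at hk; omega) hmem
        have hch := range'_sublist_of_mem (m := i + 2) (fun k hk hk' => h k hk (by omega)) hb
        have := range'_tail_sublist hch
        have := (h3 0).2 (by simpa using this)
        exact this.subset (by simp)
      obtain ⟨q, hq, hq'⟩ := exists_drop_eq_of_mem hz2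
      -- `q` is the position of the last 2 of `z`. If 3, …, i+3 followed it, the hypothesis would
      -- give a chain 1, …, i+2 after `q`, with a later 2. Otherwise `t < q`, and the 1 at `t`
      -- followed by a chain from 2 does the job.
      by_cases hcq : List.range' 3 (i + 1) <+ z.drop (q + 1)
      · exfalso
        have e1 : List.range' 2 (i + 2) <+ z.drop q := by
          rw [hq, List.range'_succ]
          exact hcq.cons_cons 2
        have e2 := (h4 q).2 (hg q ((h3 q).1 e1))
        rw [hq, range'_sublist_cons] at e2
        refine hq' ((e2.resolve_right (by omega)).subset ?_)
        simp
        omega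
      · have htq : t < q := by
          by_contra hcon
          rcases (not_lt.1 hcon).lt_or_eq with h6 | h6
          · exact hcq (hc.trans (List.drop_sublist_drop_left _ (by omega)))
          · rw [h6, hp] at hq
            simp at hq
        have e1 : List.range' 2 (i + 1) <+ z.drop (t + 1) := by
          refine (h5 (t + 1)).1 ?_
          refine (List.drop_sublist_drop_left z (show t + 1 ≤ q by omega)).subset ?_
          rw [hq]
          simp
        have e2 : List.range' 1 (i + 2) <+ z.drop t := by
          rw [hp, List.range'_succ]
          exact e1.cons_cons 1
        exact ((h4 t).1 e2).trans (List.drop_sublist_drop_left b (by omega))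

/-! ### Stability of the suffix condition -/

/-- If `φ_i(b) = 0` and `b` contains the subword `1, …, i`, then the condition on subwords fails. -/
theorem not_suffixChains {i : ℕ} {b : List ℕ} (hi : 1 ≤ i) (h : phi i b = 0)
    (hb : List.range' 1 i <+ b) : ¬ SuffixChains i b := by
  obtain ⟨i, rfl⟩ : ∃ p, i = p + 1 := ⟨i - 1, by omega⟩
  intro hg
  induction b with
  | nil => simp at hb
  | cons x w ih =>
    have hw : phi (i + 1) w = 0 := by
      rw [phi_cons] at h
      omega
    have h1 := range'_sublist_of_phi_eq_zero (by omega) h hb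
    -- The first letter can be discarded: if it starts the chain 1, …, i+2, the tail contains 2, …,
    -- i+2, hence 1, …, i+1 by the suffix condition.
    refine ih hw ?_ fun l => hg (l + 1)
    rw [range'_sublist_cons] at hb
    rcases hb with hb | ⟨rfl, hb⟩
    · exact hb
    · rw [range'_sublist_cons] at h1
      rcases h1 with h1 | ⟨-, h1⟩
      · exact (List.range'_sublist_right.2 (by omega)).trans h1
      · exact hg 1 h1

theorem suffixChains_cons_one_iff (i : ℕ) (w : List ℕ) :
    SuffixChains i (1 :: w) ↔ SuffixChains i w := by
  refine ⟨fun h l => h (l + 1), fun h l hl => ?_⟩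
  cases l with
  | succ l => exact h l hl
  | zero =>
    rw [List.drop_zero] at hl ⊢
    cases i with
    | zero => simp
    | succ i =>
      refine (h 0 ?_).trans (List.sublist_cons_self _ _)
      exact (range'_sublist_cons.1 hl).resolve_right (by omega)

theorem opF_eq_some {k : ℕ} {w w' : List ℕ} (h : opF k w = some w') :
    ∃ u v, w = u ++ k :: v ∧ w' = u ++ (k + 1) :: v ∧ phi k u = 0 ∧ eps k v = 0 := by
  induction w generalizing w' with
  | nil => simp [opF] at h
  | cons x w ih =>
    rcases opF_cons_eq_some.1 h with ⟨rfl, h1, rfl⟩ | ⟨h1, v, hv, rfl⟩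
    · exact ⟨[], w, rfl, rfl, rfl, h1⟩
    · obtain ⟨u, v, rfl, rfl, h2, h3⟩ := ih hv
      refine ⟨x :: u, v, rfl, rfl, ?_, h3⟩
      have h4 := (eps_append k u (k :: v)).1
      rw [eps_cons, h3] at h4
      rw [phi_cons, h2]
      split_ifs <;> simp at h4 <;> omega

theorem sublist_append_of_notMem {x : ℕ} {s u v : List ℕ} (hx : x ∉ s)
    (h : s <+ u ++ x :: v) : s <+ u ++ v := by
  obtain ⟨s, t, rfl, h1, h2⟩ := List.sublist_append_iff.1 h
  rw [List.mem_append, not_or] at hx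
  refine h1.append ?_
  rcases List.sublist_cons_iff.1 h2 with h2 | ⟨r, rfl, -⟩
  · exact h2
  · simp at hx

theorem range'_sublist_append_cons_succ {a m : ℕ} {u v : List ℕ}
    (h : List.range' (a + 1) (m + 1) <+ u ++ (a + 1) :: v) :
    List.range' (a + 1) (m + 1) <+ u ++ a :: v ∨ List.range' (a + 2) m <+ v := by
  induction u with
  | nil =>
    rw [List.nil_append, range'_sublist_cons] at h
    exact h.imp (fun h => h.trans (List.sublist_cons_self _ _)) And.right
  | cons y u ih =>
    rw [List.cons_append, range'_sublist_cons] at h ⊢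
    rcases h with h | ⟨rfl, h⟩
    · exact (ih h).imp Or.inl id
    · refine Or.inl (Or.inr ⟨rfl, ?_⟩)
      exact (sublist_append_of_notMem (by simp) h).trans
        ((List.sublist_cons_self _ _).append_left u)

/-- `f̃_1` can create chains starting with 2, at the changed letter. Such a chain is harmless: its
remainder also completes any 2 further left, and the suffix condition then moves a chain 1, …, i of
`w` rightwards until it lies in the suffix starting at the changed 1. -/
theorem suffixChains_opF_one_iff {i : ℕ} (hi : 1 ≤ i) {w w' : List ℕ} (h : opF 1 w = some w')
    (hP : ∀ l, List.range' 1 i <+ w'.drop l ↔ List.range' 1 i <+ w.drop l)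
    (hw : List.range' 2 i <+ w' → List.range' 1 i <+ w) :
    SuffixChains i w' ↔ SuffixChains i w := by
  have hL := lower_of_opF h
  refine ⟨fun hg l hl => (hP l).1 (hg l ((hL.drop l).range'_mono (by omega) hl)), fun hg => ?_⟩
  obtain ⟨u, v, rfl, rfl, hu, -⟩ := opF_eq_some h
  obtain ⟨i, rfl⟩ : ∃ p, i = p + 1 := ⟨i - 1, by omega⟩
  intro l hl
  rw [hP]
  by_contra hcon
  have hQ := hw (hl.trans (List.drop_sublist _ _))
  have hlu : l ≤ u.length := by
    by_contra hlt
    obtain ⟨p, rfl⟩ : ∃ p, l = u.length + (p + 1) := ⟨l - u.length - 1, by omega⟩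
    -- A suffix starting after the changed letter is the same in both words.
    refine hcon (hg _ ?_)
    simpa [← List.drop_drop] using hl
  rw [List.drop_append_of_le_length hlu] at hl hcon
  rcases range'_sublist_append_cons_succ hl with h1 | h1
  · refine hcon ?_
    rw [← List.drop_append_of_le_length hlu] at h1 ⊢
    exact hg l h1
  replace hcon : ¬ List.range' 1 (i + 1) <+ 1 :: v :=
    fun hc => hcon (hc.trans (List.sublist_append_right _ _))
  clear hl hlu hw hP hL h
  induction u with
  | nil => exact hcon hQ
  | cons y u ih =>
    rw [phi_cons] at hu
    refine ih (by omega) (fun l => hg (l + 1)) ?_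
    rw [List.cons_append, range'_sublist_cons] at hQ
    rcases hQ with hQ | ⟨rfl, -⟩
    · exact hQ
    -- As `φ_1` vanishes on the part before the changed letter, this 1 is matched by a 2 in `u`;
    -- followed by the remainder in `v`, it gives a chain from 2 to which the suffix condition
    -- applies.
    · have h2 : 2 ∈ u := mem_of_eps_pos (k := 1) (by simp at hu; omega)
      refine hg 1 ?_
      rw [List.range'_succ]
      exact (List.singleton_sublist.2 h2).append (h1.trans (List.sublist_cons_self _ _))

theorem opF_wt {k : ℕ} {w w' : List ℕ} (h : opF k w = some w') :
    wt w' + Pi.single k 1 = wt w + Pi.single (k + 1) 1 := by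
  obtain ⟨u, v, rfl, rfl, -⟩ := opF_eq_some h
  funext i
  simp only [wt, Pi.add_apply, Pi.single_apply, List.count_append, List.count_cons, beq_iff_eq]
  split_ifs <;> push_cast <;> omega

theorem opFChain_wt {m : ℕ} {w c : List ℕ} (h : opFChain m w = some c) :
    wt (1 :: c) = wt w + Pi.single (m + 1) 1 := by
  induction m generalizing w with
  | zero =>
    obtain rfl : w = c := Option.some.inj h
    funext i
    simp only [wt, Pi.add_apply, Pi.single_apply, List.count_cons, beq_iff_eq]
    split_ifs <;> push_cast <;> omega
  | succ m ih =>
    obtain ⟨w', h1, h2⟩ := Option.bind_eq_some_iff.1 h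
    rw [ih h2, opF_wt h1]

/-- The operator of largest index acts first. Each `f̃_{k+1}` removes a letter k+1, which widens the
gap at k from at least 1 to at least 2, so `φ_k ≥ 2` at every stage. -/
theorem suffixChains_opFChain_iff {i m : ℕ} (hi : 1 ≤ i) {w c : List ℕ}
    (h : opFChain m w = some c) (hm : 1 ≤ m → wt w (m + 1) + 2 ≤ wt w m)
    (hlt : ∀ k, 1 ≤ k → k < m → wt w (k + 1) + 1 ≤ wt w k)
    (hw : List.range' 2 i <+ c → List.range' 1 i <+ w) :
    SuffixChains i c ↔ SuffixChains i w := by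
  induction m generalizing w with
  | zero =>
    obtain rfl : w = c := Option.some.inj h
    rfl
  | succ m ih =>
    obtain ⟨w', h1, h2⟩ := Option.bind_eq_some_iff.1 h
    have hphi : 2 ≤ phi (m + 1) w := by
      have := phi_sub_eps (m + 1) w
      have := hm (by omega)
      omega
    have hP := range'_sublist_drop_opF_iff (a := 1) (m := i) h1 hphi
    cases m with
    | zero =>
      obtain rfl : w' = c := Option.some.inj h2
      exact suffixChains_opF_one_iff hi h1 (hP (by omega)) hw
    | succ m =>
      have hP := hP (by omega)
      have hQ := range'_sublist_drop_opF_iff (a := 2) (m := i) h1 hphi (by omega)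
      have hwt := fun k => congrFun (opF_wt h1) k
      simp only [Pi.add_apply, Pi.single_apply] at hwt
      refine (ih h2 (fun _ => ?_) (fun k hk hk' => ?_) (fun hc => (hP 0).2 (hw hc))).trans
        (forall_congr' fun l => by rw [hP, hQ])
      · have e1 := hwt (m + 1)
        have e2 := hwt (m + 1 + 1)
        have := hlt (m + 1) (by omega) (by omega)
        split_ifs at e1 e2 <;> omega
      · have e1 := hwt k
        have e2 := hwt (k + 1)
        have := hlt k hk (by omega)
        split_ifs at e1 e2 <;> omega

/-! ### Strict weights and the comparison of `b₀` with `b` -/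

theorem IsGLHighestWeight.eps_eq_zero {n : ℕ} {b : List ℕ} (h : IsGLHighestWeight n b) {k : ℕ}
    (h1 : 1 ≤ k) (h2 : k < n) : eps k b = 0 :=
  (opE_eq_none_iff k b).1 (h k h1 h2)

theorem IsGLHighestWeight.isQHighestWeight_iff {n : ℕ} {b : List ℕ}
    (h : IsGLHighestWeight n b) :
    IsQHighestWeight n b ↔ ∀ i, 1 ≤ i → i < n → SuffixChains i b :=
  forall_congr' fun i => forall_congr' fun h1 => forall_congr' fun h2 => by
    rw [opOddE_eq_none_iff h1 fun j hj hj' => h.eps_eq_zero hj (by omega)]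
    exact and_iff_right (h i h1 h2)

theorem mem_of_wt_pos {k : ℕ} {b : List ℕ} (h : 0 < wt b k) : k ∈ b :=
  List.count_pos_iff.1 (Int.natCast_pos.1 h)

theorem IsGLHighestWeight.range'_sublist {n : ℕ} {b : List ℕ} (h : IsGLHighestWeight n b) {k : ℕ}
    (h1 : 1 ≤ k) (h2 : k ≤ n) (hk : k ∈ b) : List.range' 1 k <+ b := by
  obtain ⟨k, rfl⟩ : ∃ p, k = p + 1 := ⟨k - 1, by omega⟩
  exact range'_sublist_of_mem (fun j hj hj' => h.eps_eq_zero hj (by omega)) hk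

/-- The weight of a `𝔮(n)`-highest weight vector is a strict partition. -/
theorem IsGLHighestWeight.isStrictPartition {n : ℕ} {b : List ℕ} (h : IsGLHighestWeight n b)
    (hs : ∀ i, 1 ≤ i → i < n → SuffixChains i b) : IsStrictPartition n (wt b) := by
  have hnn : ∀ i, 0 ≤ wt b i := fun i => Int.natCast_nonneg _
  refine ⟨fun i _ _ => hnn i, fun i h1 h2 => ?_⟩
  have h3 := phi_sub_eps i b
  rw [h.eps_eq_zero h1 h2] at h3
  refine ⟨by omega, fun h4 => ?_⟩
  by_contra h5
  have := hnn i
  exact not_suffixChains h1 (by omega)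
    (h.range'_sublist h1 h2.le (mem_of_wt_pos (by omega))) (hs i h1 h2)

theorem IsStrictPartition.succ_lt {n j : ℕ} {lam : ℕ → ℤ} (h : IsStrictPartition n lam)
    (hjn : j ≤ n) (hj : 0 < lam j) {k : ℕ} (h1 : 1 ≤ k) (h2 : k < j) :
    lam (k + 1) < lam k := by
  have hpos : ∀ d, d + 1 ≤ j → 0 < lam (j - d) := by
    intro d
    induction d with
    | zero => exact fun _ => hj
    | succ d ih =>
      intro hd
      have e := (h.2 (j - (d + 1)) (by omega) (by omega)).1
      rw [show j - (d + 1) + 1 = j - d by omega] at e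
      exact (ih (by omega)).trans_le e
  have hp := hpos (j - k) (by omega)
  rw [show j - (j - k) = k by omega] at hp
  obtain ⟨e1, e2⟩ := h.2 k h1 (by omega)
  rcases e1.lt_or_eq with e | e
  · exact e
  · have := e2 e.symm
    omega

theorem suffixChains_iff_of_isStrictPartition {n m i : ℕ} {b c : List ℕ}
    (hb : IsGLHighestWeight n b) (hmn : m < n) (h : opFChain m b = some c)
    (hs : IsStrictPartition n (wt b + Pi.single (m + 1) 1)) (hi : 1 ≤ i) (hin : i < n) :
    SuffixChains i (1 :: c) ↔ SuffixChains i b := by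
  have hnn : ∀ k, 0 ≤ wt b k := fun k => Int.natCast_nonneg _
  have hlt : ∀ k, 1 ≤ k → k < m + 1 → _ := fun k hk hk' =>
    hs.succ_lt (j := m + 1) hmn (by have := hnn (m + 1); simp; omega) hk hk'
  simp only [Pi.add_apply, Pi.single_apply] at hlt
  rw [suffixChains_cons_one_iff]
  refine suffixChains_opFChain_iff hi h (fun h1 => ?_) (fun k hk hk' => ?_) fun hc => ?_
  · have := hlt m h1 (by omega)
    rw [if_pos rfl, if_neg (by omega)] at this
    omega
  · have := hlt k hk (by omega)
    rw [if_neg (by omega), if_neg (by omega)] at this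
    omega
  -- For `i ≤ m` strict decrease of the weight gives `i ∈ b`. For `i > m` the letter i+1 of `c` is
  -- not created by `f̃_1, …, f̃_m`, so it is already in `b`.
  · rcases Nat.lt_or_ge i (m + 1) with him | him
    · refine hb.range'_sublist hi hin.le (mem_of_wt_pos ?_)
      have := hlt i hi him
      rw [if_neg (show i ≠ m + 1 by omega)] at this
      have := hnn (i + 1)
      split_ifs at * <;> omega
    · have h1 : i + 1 ∈ 1 :: c := List.mem_cons_of_mem _ (hc.subset (by simp; omega))
      have h2 : 0 < wt (1 :: c) (i + 1) := by
        simpa [wt] using List.count_pos_iff.2 h1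
      rw [opFChain_wt h, Pi.add_apply, Pi.single_eq_of_ne (by omega), add_zero] at h2
      exact (List.range'_sublist_right.2 (by omega)).trans
        (hb.range'_sublist (by omega) hin (mem_of_wt_pos h2))

end QueerCrystal

theorem mainTheorem5 (n N j : ℕ) (hn : 2 ≤ n) (hN : 1 ≤ N) (hj : 1 ≤ j) (hjn : j ≤ n)
    (b b₀ : List ℕ)
    (hb : b ∈ QueerCrystal.tensorPow n (N - 1))
    (hbGL : QueerCrystal.IsGLHighestWeight n b)
    (hb₀ : b₀ ∈ QueerCrystal.tensorPow n N)
    (hb₀def : (QueerCrystal.opFChain (j - 1) b).map (fun w => 1 :: w) = some b₀)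
    (hb₀GL : QueerCrystal.IsGLHighestWeight n b₀) :
    QueerCrystal.wt b₀ = QueerCrystal.wt b + Pi.single j 1 ∧
    (QueerCrystal.IsQHighestWeight n b₀ ↔
      QueerCrystal.IsQHighestWeight n b ∧
      QueerCrystal.IsStrictPartition n (QueerCrystal.wt b + Pi.single j 1)) := by
  obtain ⟨m, rfl⟩ : ∃ p, j = p + 1 := ⟨j - 1, by omega⟩
  obtain ⟨c, hc, rfl⟩ := Option.map_eq_some_iff.1 hb₀def
  rw [Nat.add_sub_cancel] at hc
  have hwt := QueerCrystal.opFChain_wt hc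
  refine ⟨hwt, ?_⟩
  rw [hb₀GL.isQHighestWeight_iff, hbGL.isQHighestWeight_iff, ← hwt]
  have key := fun hs i => QueerCrystal.suffixChains_iff_of_isStrictPartition
    (i := i) hbGL (by omega) hc hs
  rw [← hwt] at key
  constructor
  · intro h
    have hs := hb₀GL.isStrictPartition h
    exact ⟨fun i h1 h2 => (key hs i h1 h2).1 (h i h1 h2), hs⟩
  · rintro ⟨h, hs⟩ i h1 h2
    exact (key hs i h1 h2).2 (h i h1 h2)
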